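/- Let $\Delta x,\Delta t>0$, $x_i=i\Delta x$ ($i\in\mathbb Z$), $t_n=n\Delta t$ ($n\in\mathbb N$), and $\|W\|_2=\big(\Delta x\sum_{j\in\mathbb Z}w_j^2\big)^{1/2}$ for $W\in\ell^2(\mathbb Z)$. Given a diffusivity $\nu(x,t)\ge 0$, let the displacements $\delta_i^{\pm}=\delta_i^{\pm,n}$ be solutions of $$\delta_i^\pm=\sqrt{2\Delta t\,\nu(x_i\pm\delta_i^\pm,t_n)} .$$ Given points $z_i=z_i^n\in\mathbb R$ (feet of approximate characteristics; $z_i=x_i$ without advection) and an interpolation operator $I$, mapping sequences $(v_i)_{i\in\mathbb Z}$ to functions on $\mathbb R$, consider the scheme $$v_i^{n+1}=\tfrac12 I[V^n](z_i+\delta_i^+)+\tfrac12 I[V^n](z_i-\delta_i^-)$$ and the operators $(B^+W)_i=I[W](z_i+\delta_i^+)$ and $(B^-W)_i=I[W](z_i-\delta_i^-)$, which may depend on $n$. Lagrange interpolation of degree $p\ge1$ means that $I_p[V](x)$ is the value at $x$ of the polynomial of degree at most $p$ that takes the values $v_j$ at $p+1$ consecutive nodes $x_j$ forming a centred stencil for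 $x$: the number of stencil nodes $\le x$ and the number of stencil nodes $>x$ differ by at most one, and the stencil of $x+\Delta x$ is the stencil of $x$ shifted by one node. Then: 1. The scheme is $V^{n+1}=\tfrac12B^+V^n+\tfrac12B^-V^n$. 2. If $\nu\equiv\nu_0\ge 0$ is constant, the equations for the displacements are equivalent to $\delta_i^\pm=\delta:=\sqrt{2\Delta t\,\nu_0}$ for all $i$ and $n$. 3. Let $\nu\equiv\nu_0\ge 0$ and $z_i=x_i-a\Delta t$ with a constant $a\in\mathbb R$ ($a=0$ is the pure diffusion equation). For every $p\ge1$ and Lagrange interpolation of degree $p$, the operators $B^\pm$ map $\ell^2(\mathbb Z)$ to itself and have operator norm $\|B^\pm\|_2=1$; in particular they are nonexpansive. The scheme is $\ell^2$-stable: if $V^0\in\ell^2(\mathbb Z)$, then $V^n\in\ell^2(\mathbb Z)$, $\|V^{n+1}\|_2\le\|V^n\|_2$ and $\|V^n\|_2\le\|V^0\|_2$ for all $n\ge0$. 4. Let $\nu\ge 0$ be variable and the points $z_i^n$ arbitrary. For any interpolation operator $I$, if at step $n$ the operators $B^+$ and $B^-$ are monotone (with respect to the componentwise order), then so is $V\mapsto\tfrac12B^+V+\tfrac12B^-V$.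 For $\mathbb P_1$ interpolation ($p=1$) the operators $B^\pm$, and hence the scheme, are monotone at every step. -/

import Mathlib

namespace SLDiff

/-- The nodes `x_i = i Δx` of the infinite uniform grid. -/
def node (Δx : ℝ) (i : ℤ) : ℝ := (i : ℝ) * Δx

/-- `W` belongs to `ℓ²(ℤ)`. -/
def IsL2 (W : ℤ → ℝ) : Prop := Summable fun j => W j ^ 2

/-- The discrete norm `‖W‖₂ = (Δx ∑_j w_j²)^{1/2}` (meaningful for `IsL2 W`). -/
noncomputable def l2norm (Δx : ℝ) (W : ℤ → ℝ) : ℝ := √(Δx * ∑' j, W j ^ 2)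

/-- `c` is the operator norm of `B` on `ℓ²(ℤ)`: the operator maps `ℓ²` to itself, and `c` is the
least bound of `‖B W‖₂ / ‖W‖₂`. -/
def HasL2OpNorm (Δx : ℝ) (B : (ℤ → ℝ) → ℤ → ℝ) (c : ℝ) : Prop :=
  (∀ W, IsL2 W → IsL2 (B W)) ∧
    IsLeast {C : ℝ | 0 ≤ C ∧ ∀ W, IsL2 W → l2norm Δx (B W) ≤ C * l2norm Δx W} c

/-- A centred choice of interpolation stencils of degree `p` on a uniform grid. A point with grid
coordinate `ξ = x / Δx` is assigned the `p + 1` consecutive nodes of index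
`start ξ, …, start ξ + p`. The choice commutes with shifts by whole cells, and the number
`⌊ξ⌋ - start ξ + 1` of stencil nodes `≤ ξ` and the number `start ξ + p - ⌊ξ⌋` of stencil
nodes `> ξ` differ by at most one. (So they are equal when `p` is odd.) -/
structure CentredStencil (p : ℕ) where
  start : ℝ → ℤ
  start_add_one : ∀ ξ, start (ξ + 1) = start ξ + 1
  balanced : ∀ ξ, |(⌊ξ⌋ - start ξ + 1) - (start ξ + p - ⌊ξ⌋)| ≤ 1

/-- Centred stencils exist in every degree: the `p + 1` nodes nearest to the point. -/
noncomputable def CentredStencil.nearest (p : ℕ) : CentredStencil p where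
  start ξ := ⌊ξ - ((p : ℝ) - 1) / 2⌋
  start_add_one ξ := by
    rw [show ξ + 1 - ((p : ℝ) - 1) / 2 = (ξ - ((p : ℝ) - 1) / 2) + 1 by ring, Int.floor_add_one]
  balanced ξ := by
    have h1 := Int.floor_le ξ
    have h2 := Int.lt_floor_add_one ξ
    have h3 := Int.floor_le (ξ - ((p : ℝ) - 1) / 2)
    have h4 := Int.lt_floor_add_one (ξ - ((p : ℝ) - 1) / 2)
    set j := ⌊ξ⌋
    set m := ⌊ξ - ((p : ℝ) - 1) / 2⌋
    have h5 : 2 * (j - m) + 1 - (p : ℤ) < 2 := by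
      have : ((2 * (j - m) + 1 - (p : ℤ) : ℤ) : ℝ) < (2 : ℤ) := by push_cast; linarith
      exact_mod_cast this
    have h6 : -2 < 2 * (j - m) + 1 - (p : ℤ) := by
      have : ((-2 : ℤ) : ℝ) < ((2 * (j - m) + 1 - (p : ℤ) : ℤ) : ℝ) := by push_cast; linarith
      exact_mod_cast this
    rw [abs_le]
    constructor <;> linarith

/-- Piecewise Lagrange interpolation `I_p[V](x)` of degree `p`: the value at `x` of the polynomial
of degree at most `p` that takes the values `v_j` at the `p + 1` nodes `x_j` of the stencil of
`x`. -/
noncomputable def lagrangeInterp (Δx : ℝ) {p : ℕ} (S : CentredStencil p)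
    (V : ℤ → ℝ) (x : ℝ) : ℝ :=
  (Lagrange.interpolate (Finset.Icc (S.start (x / Δx)) (S.start (x / Δx) + p))
    (node Δx) V).eval x

/-- The diffusive displacements of sign `σ = ± 1`: at each time `t_n = n Δt` and each node,
`δ_i = √(2 Δt ν(x_i + σ δ_i, t_n))`. -/
def IsDisplacement (Δx Δt : ℝ) (ν : ℝ → ℝ → ℝ) (σ : ℝ) (δ : ℕ → ℤ → ℝ) : Prop :=
  ∀ n i, δ n i = √(2 * Δt * ν (node Δx i + σ * δ n i) (n * Δt))

/-- The operator `B⁺` at step `n`: `(B⁺ W)_i = I[W](z_i + δ_i⁺)`. Here `z n i` is the foot of the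
approximate characteristic through `x_i`; `z n i = x_i` when there is no advection. -/
def opPlus (I : (ℤ → ℝ) → ℝ → ℝ) (z δp : ℕ → ℤ → ℝ) (n : ℕ) (W : ℤ → ℝ) : ℤ → ℝ :=
  fun i => I W (z n i + δp n i)

/-- The operator `B⁻` at step `n`: `(B⁻ W)_i = I[W](z_i - δ_i⁻)`. -/
def opMinus (I : (ℤ → ℝ) → ℝ → ℝ) (z δm : ℕ → ℤ → ℝ) (n : ℕ) (W : ℤ → ℝ) : ℤ → ℝ :=
  fun i => I W (z n i - δm n i)

/-- One step of the semi-Lagrangian scheme, node by node. -/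
noncomputable def step (I : (ℤ → ℝ) → ℝ → ℝ) (z δp δm : ℕ → ℤ → ℝ) (n : ℕ)
    (V : ℤ → ℝ) : ℤ → ℝ :=
  fun i => 1 / 2 * I V (z n i + δp n i) + 1 / 2 * I V (z n i - δm n i)

/-- `V` is a numerical solution: `V^{n+1}` is obtained from `V^n` by one step of the scheme. -/
def IsSolution (I : (ℤ → ℝ) → ℝ → ℝ) (z δp δm : ℕ → ℤ → ℝ) (V : ℕ → ℤ → ℝ) : Prop :=
  ∀ n, V (n + 1) = step I z δp δm n (V n)

end SLDiff

/-! With constant coefficients, interpolation commutes with grid shifts, so `B⁺` and `B⁻` are finite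
convolutions with fixed Lagrange weights `w_j`. By Parseval such an operator is an `ℓ²` contraction
once its symbol `∑ w_j z^j` satisfies `|·| ≤ 1` on the unit circle.

Put `z = e^{2iφ}` and let `τ` be the grid coordinate measured from the stencil centre. Up to a
phase, the symbol is the value at `τ` of the interpolant of `e^{2iτφ}` at the nodes `k - p/2`, `0 ≤
k ≤ p`. This interpolant is explicit: truncate the expansions of `cos (2τφ)` and `sin (2τφ)` in
powers of `s = sin φ`, giving `X = sineTrunc` and `Y = cos φ * secTrunc`. As functions of `φ` they
satisfy the equations of rotation at speed `2τ`, except for one remainder `-(p+1) b_{p+1}(τ) sᵖ` in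
`Y'`. At the nodes `b_{p+1}` vanishes, so the truncation is exact there
(`eval_cosTrunc_sinTrunc_node`). Elsewhere `(X² + Y²)' = -2(p+1) sᵖ b_{p+1} Y`. On a centred stencil
`|τ| ≤ 1/2` (`p` odd) or `|τ| ≤ 1` (`p` even), and then the `b_m` occurring here all have one sign.
So `X² + Y²` decreases from `1` on `[0, π/2]` (`sineTrunc_sq_add_le_one`).

The norm is not below `1` because the weights sum to one: long indicator sequences are nearly
preserved. Stability of the mean follows by convexity, and `ℙ₁` monotonicity from nonnegative
weights. -/

namespace SLDiff

/-! ### Truncated expansions of the trigonometric functions in powers of the sine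

With `s = sin φ`, the functions `cos (2τφ)` and `sin (2τφ)` have the expansions `∑ aₘ(τ) sᵐ` over
the even and the odd `m`, and `sin (2τφ) / cos φ` and `cos (2τφ) / cos φ` have the expansions
`∑ bₘ(τ) sᵐ` over the odd and the even `m`. All the coefficients are polynomials in `τ`. -/

section Trig

open Polynomial

/-- The coefficients `aₘ(τ)` of `cos (2τφ)` (`m` even) and `sin (2τφ)` (`m` odd) in powers of
`sin φ`. -/
noncomputable def sineCoeff : ℕ → ℝ[X]
  | 0 => 1
  | 1 => C 2 * X
  | m + 2 => C (1 / (((m : ℝ) + 1) * (m + 2))) * (C ((m : ℝ) ^ 2) - C 4 * X ^ 2) * sineCoeff m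

/-- The coefficients `bₘ(τ)` of `cos (2τφ) / cos φ` (`m` even) and `sin (2τφ) / cos φ` (`m` odd)
in powers of `sin φ`. -/
noncomputable def secCoeff : ℕ → ℝ[X]
  | 0 => 1
  | 1 => C 2 * X
  | m + 2 => C (1 / (((m : ℝ) + 1) * (m + 2))) * (C (((m : ℝ) + 1) ^ 2) - C 4 * X ^ 2) * secCoeff m

/-- The sum of `aₘ(τ) sᵐ` over the `m ≤ p` of the parity of `p`, as a polynomial in `τ`. -/
noncomputable def sineTrunc : ℕ → ℝ → ℝ[X]
  | 0, _ => 1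
  | 1, s => C (2 * s) * X
  | p + 2, s => sineTrunc p s + C (s ^ (p + 2)) * sineCoeff (p + 2)

/-- The sum of `bₘ(τ) sᵐ` over the `m < p` of the parity opposite to `p`, as a polynomial
in `τ`. -/
noncomputable def secTrunc : ℕ → ℝ → ℝ[X]
  | 0, _ => 0
  | 1, _ => 1
  | p + 2, s => secTrunc p s + C (s ^ (p + 1)) * secCoeff (p + 1)

/-! ### Degree bounds in `τ`, needed for uniqueness of the interpolant. -/

theorem natDegree_quadratic_mul_le (a b : ℝ) {P : ℝ[X]} {m : ℕ} (h : P.natDegree ≤ m) :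
    (C a * (C b - C 4 * X ^ 2) * P).natDegree ≤ m + 2 := by
  have h1 : (C a * (C b - C 4 * X ^ 2) : ℝ[X]).natDegree ≤ 2 := by compute_degree
  exact (natDegree_mul_le_of_le h1 h).trans (by omega)

theorem natDegree_sineCoeff_le (m : ℕ) : (sineCoeff m).natDegree ≤ m := by
  induction m using Nat.twoStepInduction with
  | zero => simp [sineCoeff]
  | one => rw [sineCoeff]; compute_degree
  | more m ih _ => rw [sineCoeff]; exact natDegree_quadratic_mul_le _ _ ih

theorem natDegree_secCoeff_le (m : ℕ) : (secCoeff m).natDegree ≤ m := by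
  induction m using Nat.twoStepInduction with
  | zero => simp [secCoeff]
  | one => rw [secCoeff]; compute_degree
  | more m ih _ => rw [secCoeff]; exact natDegree_quadratic_mul_le _ _ ih

theorem natDegree_sineTrunc_le (p : ℕ) (s : ℝ) : (sineTrunc p s).natDegree ≤ p := by
  induction p using Nat.twoStepInduction with
  | zero => simp [sineTrunc]
  | one => rw [sineTrunc]; compute_degree
  | more p ih _ =>
    rw [sineTrunc]
    exact natDegree_add_le_of_degree_le (ih.trans (by omega))
      ((natDegree_C_mul_le _ _).trans (natDegree_sineCoeff_le _))

theorem natDegree_secTrunc_le (p : ℕ) (s : ℝ) : (secTrunc p s).natDegree ≤ p := by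
  induction p using Nat.twoStepInduction with
  | zero => simp [secTrunc]
  | one => simp [secTrunc]
  | more p ih _ =>
    rw [secTrunc]
    exact natDegree_add_le_of_degree_le (ih.trans (by omega))
      ((natDegree_C_mul_le _ _).trans ((natDegree_secCoeff_le _).trans (by omega)))

theorem eval_sineCoeff_add_two (m : ℕ) (τ : ℝ) :
    ((m : ℝ) + 1) * (m + 2) * (sineCoeff (m + 2)).eval τ =
      ((m : ℝ) ^ 2 - 4 * τ ^ 2) * (sineCoeff m).eval τ := by
  rw [sineCoeff]
  simp only [eval_mul, eval_sub, eval_C, eval_pow, eval_X]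
  field_simp

theorem eval_secCoeff_add_two (m : ℕ) (τ : ℝ) :
    ((m : ℝ) + 1) * (m + 2) * (secCoeff (m + 2)).eval τ =
      (((m : ℝ) + 1) ^ 2 - 4 * τ ^ 2) * (secCoeff m).eval τ := by
  rw [secCoeff]
  simp only [eval_mul, eval_sub, eval_C, eval_pow, eval_X]
  field_simp

/-- Compares coefficients in the `φ`-derivative of `∑ aₘ sᵐ`, a factor `cos φ` being cancelled. -/
theorem eval_sineCoeff_succ (m : ℕ) (τ : ℝ) :
    ((m : ℝ) + 1) * (sineCoeff (m + 1)).eval τ =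
      (-1) ^ m * (2 * τ) * (secCoeff m).eval τ := by
  induction m using Nat.twoStepInduction with
  | zero => simp [sineCoeff, secCoeff]
  | one =>
    have h := eval_sineCoeff_add_two 0 τ
    simp [sineCoeff, secCoeff] at h ⊢
    ring
  | more m ih _ =>
    have h1 := eval_sineCoeff_add_two (m + 1) τ
    have h2 := eval_secCoeff_add_two m τ
    push_cast at h1 ⊢
    have h3 : ((m : ℝ) + 1) * (m + 2) ≠ 0 := by positivity
    apply mul_left_cancel₀ h3
    rw [show m + 1 + 2 = m + 2 + 1 from rfl] at h1
    linear_combination ((m : ℝ) + 1) * h1 + (((m : ℝ) + 1) ^ 2 - 4 * τ ^ 2) * ih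
      - (-1) ^ m * (2 * τ) * h2

theorem hasDerivAt_sineTrunc (p : ℕ) (τ φ : ℝ) :
    HasDerivAt (fun φ => (sineTrunc p (Real.sin φ)).eval τ)
      ((-1) ^ (p + 1) * (2 * τ) * (Real.cos φ * (secTrunc p (Real.sin φ)).eval τ)) φ := by
  induction p using Nat.twoStepInduction with
  | zero => simpa [sineTrunc, secTrunc] using hasDerivAt_const φ (1 : ℝ)
  | one =>
    simp only [sineTrunc, secTrunc, eval_mul, eval_C, eval_X, eval_one]
    refine HasDerivAt.congr_deriv (((Real.hasDerivAt_sin φ).const_mul 2).mul_const τ) ?_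
    ring
  | more p ih _ =>
    simp only [sineTrunc, secTrunc, eval_add, eval_mul, eval_C]
    refine HasDerivAt.congr_deriv (ih.add (((Real.hasDerivAt_sin φ).pow (p + 2)).mul_const
      ((sineCoeff (p + 2)).eval τ))) ?_
    have h := eval_sineCoeff_succ (p + 1) τ
    push_cast at h ⊢
    linear_combination Real.sin φ ^ (p + 1) * Real.cos φ * h

/-- The coefficient of `s^(p+2)` in the `φ`-derivative of `cos φ * ∑ bₘ sᵐ`, with `cos² φ = 1 - s²`.
-/
theorem eval_secCoeff_balance (p : ℕ) (τ : ℝ) :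
    ((p : ℝ) + 2) * (secCoeff (p + 1)).eval τ =
      (-1) ^ (p + 1) * (2 * τ) * (sineCoeff (p + 2)).eval τ +
        (p + 3) * (secCoeff (p + 3)).eval τ := by
  have h1 := eval_sineCoeff_succ (p + 1) τ
  have h2 := eval_secCoeff_add_two (p + 1) τ
  push_cast at h1 h2
  have h3 : ((-1 : ℝ) ^ (p + 1)) ^ 2 = 1 := by rw [← pow_mul, mul_comm, pow_mul]; simp
  have h4 : ((p : ℝ) + 2) ≠ 0 := by positivity
  apply mul_left_cancel₀ h4
  rw [show p + 1 + 2 = p + 3 from rfl] at h2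
  rw [show p + 1 + 1 = p + 2 from rfl] at h1
  linear_combination -(-1) ^ (p + 1) * (2 * τ) * h1 - h2
    - 4 * τ ^ 2 * (secCoeff (p + 1)).eval τ * h3

/-- The terms telescope by `eval_secCoeff_balance`; the last one is what the first omitted term
`b_{p+1} s^(p+1)` would have cancelled. -/
theorem hasDerivAt_secTrunc (p : ℕ) (τ φ : ℝ) :
    HasDerivAt (fun φ => Real.cos φ * (secTrunc p (Real.sin φ)).eval τ)
      (-((-1) ^ (p + 1) * (2 * τ) * (sineTrunc p (Real.sin φ)).eval τ) -
        (p + 1) * (secCoeff (p + 1)).eval τ * Real.sin φ ^ p) φ := by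
  induction p using Nat.twoStepInduction with
  | zero => simpa [sineTrunc, secTrunc, secCoeff] using hasDerivAt_const φ (0 : ℝ)
  | one =>
    simp only [sineTrunc, secTrunc, eval_mul, eval_C, eval_X, eval_one, mul_one]
    convert Real.hasDerivAt_cos φ using 1
    have h := eval_secCoeff_add_two 0 τ
    simp [secCoeff] at h ⊢
    ring
  | more p ih _ =>
    simp only [sineTrunc, secTrunc, eval_add, eval_mul, eval_C, mul_add]
    refine HasDerivAt.congr_deriv (ih.add ((Real.hasDerivAt_cos φ).mul
      (((Real.hasDerivAt_sin φ).pow (p + 1)).mul_const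
      ((secCoeff (p + 1)).eval τ)))) ?_
    have h := eval_secCoeff_balance p τ
    have h2 := Real.sin_sq_add_cos_sq φ
    push_cast
    rw [show p + 2 + 1 = p + 3 from rfl]
    linear_combination -Real.sin φ ^ (p + 2) * h
      + (p + 1) * (secCoeff (p + 1)).eval τ * Real.sin φ ^ p * h2

/-- The sign condition that makes the truncation errors decrease the modulus. -/
theorem secCoeff_mul_nonneg {τ : ℝ} {p : ℕ} (hp : Odd p → 4 * τ ^ 2 ≤ 1)
    (hp' : Even p → 4 * τ ^ 2 ≤ 4) (c : ℝ) {m : ℕ} (hm : Even (m + p + 1))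
    (h0 : 0 ≤ c * (secCoeff ((p + 1) % 2)).eval τ) :
    0 ≤ c * (secCoeff m).eval τ := by
  induction m using Nat.twoStepInduction with
  | zero =>
    have : (p + 1) % 2 = 0 := by grind
    rwa [this] at h0
  | one =>
    have : (p + 1) % 2 = 1 := by grind
    rwa [this] at h0
  | more m ih _ =>
    have ih := ih (by grind)
    have h := eval_secCoeff_add_two m τ
    have h4 : 4 * τ ^ 2 ≤ ((m : ℝ) + 1) ^ 2 := by
      have hm0 : (0 : ℝ) ≤ m := m.cast_nonneg
      rcases Nat.even_or_odd p with he | ho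
      · have h5 : 1 ≤ m := by
          rcases m with _ | m
          · grind
          · omega
        have h6 : (1 : ℝ) ≤ m := by exact_mod_cast h5
        nlinarith [hp' he]
      · nlinarith [hp ho]
    have h3 : 0 < ((m : ℝ) + 1) * (m + 2) := by positivity
    refine nonneg_of_mul_nonneg_right (a := ((m : ℝ) + 1) * (m + 2)) ?_ h3
    rw [show ((m : ℝ) + 1) * (m + 2) * (c * (secCoeff (m + 2)).eval τ) =
      (((m : ℝ) + 1) ^ 2 - 4 * τ ^ 2) * (c * (secCoeff m).eval τ) by linear_combination c * h]
    exact mul_nonneg (by linarith) ih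

theorem secCoeff_mul_secTrunc_nonneg {τ : ℝ} {p : ℕ} (hp : Odd p → 4 * τ ^ 2 ≤ 1)
    (hp' : Even p → 4 * τ ^ 2 ≤ 4) {s : ℝ} (hs : 0 ≤ s) :
    0 ≤ (secCoeff (p + 1)).eval τ * (secTrunc p s).eval τ := by
  -- Propagating the sign from the square of the lowest coefficient gives the base case with `c =
  -- b_{p+1}`.
  have hbase : 0 ≤ (secCoeff (p + 1)).eval τ * (secCoeff ((p + 1) % 2)).eval τ := by
    rw [mul_comm]
    refine secCoeff_mul_nonneg hp hp' _ (by grind) (mul_self_nonneg _)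
  suffices H : ∀ q, Even (q + p) → 0 ≤ (secCoeff (p + 1)).eval τ * (secTrunc q s).eval τ from
    H p (by grind)
  intro q
  induction q using Nat.twoStepInduction with
  | zero => simp [secTrunc]
  | one =>
    intro hq
    have : (p + 1) % 2 = 0 := by grind
    simpa [this, secTrunc, secCoeff] using hbase
  | more q ih _ =>
    intro hq
    have h1 := ih (by grind)
    have h2 := secCoeff_mul_nonneg hp hp' _ (m := q + 1) (by grind) hbase
    rw [secTrunc, eval_add, eval_mul, eval_C, mul_add]
    have h3 := mul_nonneg (pow_nonneg hs (q + 1)) h2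
    linarith

/-- Passing from `p` to `p + 2` adds the end nodes `±(p+2)/2`, killed by the new factor `(p+2)² -
4τ²`; the inner nodes are the old ones with `k` shifted by one. -/
theorem secCoeff_eval_node {p k : ℕ} (hk : k ≤ p) {τ : ℝ} (hτ : 2 * τ = 2 * k - p) :
    (secCoeff (p + 1)).eval τ = 0 := by
  induction p using Nat.twoStepInduction generalizing k with
  | zero =>
    obtain rfl : k = 0 := by omega
    simp at hτ
    simp [secCoeff, hτ]
  | one =>
    have h := eval_secCoeff_add_two 0 τ
    have : 4 * τ ^ 2 = 1 := by
      have : 4 * τ ^ 2 = (2 * τ) ^ 2 := by ring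
      rw [this, hτ]
      interval_cases k <;> norm_num
    norm_num [this] at h
    exact h
  | more p ih _ =>
    have h := eval_secCoeff_add_two (p + 1) τ
    have h3 : ((p + 1 : ℕ) + 1 : ℝ) * ((p + 1 : ℕ) + 2) ≠ 0 := by positivity
    refine (mul_eq_zero.1 (h.trans ?_)).resolve_left h3
    push_cast at hτ ⊢
    rcases Nat.eq_zero_or_pos k with rfl | hk0
    · have : (p + 1 + 1 : ℝ) ^ 2 - 4 * τ ^ 2 = 0 := by
        rw [show 4 * τ ^ 2 = (2 * τ) ^ 2 by ring, hτ]; push_cast; ring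
      rw [this, zero_mul]
    rcases hk.eq_or_lt with rfl | hk1
    · have : (p + 1 + 1 : ℝ) ^ 2 - 4 * τ ^ 2 = 0 := by
        rw [show 4 * τ ^ 2 = (2 * τ) ^ 2 by ring, hτ]; push_cast; ring
      rw [this, zero_mul]
    obtain ⟨l, rfl⟩ : ∃ l, k = l + 1 := ⟨k - 1, by omega⟩
    rw [ih (k := l) (by omega) (by push_cast at hτ; linarith), mul_zero]

theorem sineTrunc_zero (p : ℕ) (τ : ℝ) :
    (sineTrunc p 0).eval τ = if Even p then 1 else 0 := by
  induction p using Nat.twoStepInduction with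
  | zero => simp [sineTrunc]
  | one => simp [sineTrunc]
  | more p ih _ =>
    simp only [sineTrunc, eval_add, ih]
    simp [Nat.even_add]

theorem secTrunc_zero (p : ℕ) (τ : ℝ) :
    (secTrunc p 0).eval τ = if Even p then 0 else 1 := by
  induction p using Nat.twoStepInduction with
  | zero => simp [secTrunc]
  | one => simp [secTrunc]
  | more p ih _ =>
    simp only [secTrunc, eval_add, ih]
    simp [Nat.even_add]

/-- The truncated expansions have modulus at most one. -/
theorem sineTrunc_sq_add_le_one {τ : ℝ} {p : ℕ} (hp : Odd p → 4 * τ ^ 2 ≤ 1)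
    (hp' : Even p → 4 * τ ^ 2 ≤ 4) {φ : ℝ} (hφ : 0 ≤ Real.sin φ) :
    (sineTrunc p (Real.sin φ)).eval τ ^ 2 +
      (Real.cos φ * (secTrunc p (Real.sin φ)).eval τ) ^ 2 ≤ 1 := by
  let F : ℝ → ℝ := fun φ => (sineTrunc p (Real.sin φ)).eval τ ^ 2 +
      (Real.cos φ * (secTrunc p (Real.sin φ)).eval τ) ^ 2
  have hF : ∀ φ, HasDerivAt F (-(2 * (p + 1) * Real.sin φ ^ p * Real.cos φ *
      ((secCoeff (p + 1)).eval τ * (secTrunc p (Real.sin φ)).eval τ))) φ := by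
    intro φ
    refine HasDerivAt.congr_deriv (((hasDerivAt_sineTrunc p τ φ).pow 2).add
      ((hasDerivAt_secTrunc p τ φ).pow 2)) ?_
    push_cast
    ring
  have hanti : AntitoneOn F (Set.Icc 0 (Real.pi / 2)) := by
    refine antitoneOn_of_deriv_nonpos (convex_Icc _ _)
      (fun x _ => (hF x).continuousAt.continuousWithinAt)
      (fun x _ => (hF x).differentiableAt.differentiableWithinAt) fun x hx => ?_
    rw [interior_Icc] at hx
    rw [(hF x).deriv, neg_nonpos]
    have hs : 0 ≤ Real.sin x :=
      Real.sin_nonneg_of_nonneg_of_le_pi hx.1.le (by linarith [hx.2, Real.pi_pos])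
    have hc : 0 ≤ Real.cos x := Real.cos_nonneg_of_mem_Icc ⟨by linarith [hx.1, Real.pi_pos], hx.2.le⟩
    have := secCoeff_mul_secTrunc_nonneg hp hp' hs
    positivity
  have h0 : F 0 = 1 := by
    simp only [F, Real.sin_zero, Real.cos_zero, sineTrunc_zero, secTrunc_zero]
    split_ifs <;> norm_num
  have h1 : F (Real.arcsin (Real.sin φ)) ≤ 1 := by
    rw [← h0]
    have := Real.arcsin_nonneg.2 hφ
    exact hanti ⟨le_rfl, by positivity⟩ ⟨this, Real.arcsin_le_pi_div_two _⟩ this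
  -- `F` depends on `φ` only through `sin φ` and `cos² φ`, which reduces to `[0, π/2]`.
  have h2 : F (Real.arcsin (Real.sin φ)) = F φ := by
    simp only [F]
    rw [Real.sin_arcsin (Real.neg_one_le_sin _) (Real.sin_le_one _), mul_pow, mul_pow,
      Real.cos_sq', Real.cos_sq', Real.sin_arcsin (Real.neg_one_le_sin _) (Real.sin_le_one _)]
  exact h2.symm.le.trans h1

/-- Uniqueness for the rotation equations: the squared distance between two solutions is constant.
-/
theorem eq_cos_sin_of_hasDerivAt {u v : ℝ → ℝ} {κ : ℝ}
    (hu : ∀ φ, HasDerivAt u (-(κ * v φ)) φ) (hv : ∀ φ, HasDerivAt v (κ * u φ) φ)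
    (hu0 : u 0 = 1) (hv0 : v 0 = 0) (φ : ℝ) :
    u φ = Real.cos (κ * φ) ∧ v φ = Real.sin (κ * φ) := by
  have hc : ∀ φ, HasDerivAt (fun φ => Real.cos (κ * φ)) (-Real.sin (κ * φ) * κ) φ := fun φ => by
    simpa using ((hasDerivAt_id φ).const_mul κ).cos
  have hs : ∀ φ, HasDerivAt (fun φ => Real.sin (κ * φ)) (Real.cos (κ * φ) * κ) φ := fun φ => by
    simpa using ((hasDerivAt_id φ).const_mul κ).sin
  have hd : ∀ φ, HasDerivAt
      (fun φ => (u φ - Real.cos (κ * φ)) ^ 2 + (v φ - Real.sin (κ * φ)) ^ 2) 0 φ := fun φ => by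
    refine HasDerivAt.congr_deriv ((((hu φ).sub (hc φ)).pow 2).add (((hv φ).sub (hs φ)).pow 2)) ?_
    simp only [Pi.sub_apply]
    push_cast
    ring
  have h := is_const_of_deriv_eq_zero (fun φ => (hd φ).differentiableAt)
    (fun φ => (hd φ).deriv) φ 0
  simp only [hu0, hv0, mul_zero, Real.cos_zero, Real.sin_zero, sub_self] at h
  constructor <;> nlinarith [sq_nonneg (u φ - Real.cos (κ * φ)), sq_nonneg (v φ - Real.sin (κ * φ))]

/-- The truncated expansion of `cos (2τφ)`. -/
noncomputable def cosTrunc (p : ℕ) (φ : ℝ) : ℝ[X] :=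
  if Even p then sineTrunc p (Real.sin φ) else C (Real.cos φ) * secTrunc p (Real.sin φ)

/-- The truncated expansion of `sin (2τφ)`. -/
noncomputable def sinTrunc (p : ℕ) (φ : ℝ) : ℝ[X] :=
  if Even p then C (Real.cos φ) * secTrunc p (Real.sin φ) else sineTrunc p (Real.sin φ)

theorem natDegree_cosTrunc_le (p : ℕ) (φ : ℝ) : (cosTrunc p φ).natDegree ≤ p := by
  unfold cosTrunc
  split_ifs
  · exact natDegree_sineTrunc_le _ _
  · exact (natDegree_C_mul_le _ _).trans (natDegree_secTrunc_le _ _)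

theorem natDegree_sinTrunc_le (p : ℕ) (φ : ℝ) : (sinTrunc p φ).natDegree ≤ p := by
  unfold sinTrunc
  split_ifs
  · exact (natDegree_C_mul_le _ _).trans (natDegree_secTrunc_le _ _)
  · exact natDegree_sineTrunc_le _ _

theorem cosTrunc_sq_add_sinTrunc_sq_le_one {τ : ℝ} {p : ℕ} (hp : Odd p → 4 * τ ^ 2 ≤ 1)
    (hp' : Even p → 4 * τ ^ 2 ≤ 4) {φ : ℝ} (hφ : 0 ≤ Real.sin φ) :
    (cosTrunc p φ).eval τ ^ 2 + (sinTrunc p φ).eval τ ^ 2 ≤ 1 := by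
  have h := sineTrunc_sq_add_le_one hp hp' hφ
  unfold cosTrunc sinTrunc
  split_ifs
  · simpa using h
  · rw [add_comm]; simpa using h

/-- The truncated expansions are exact at the nodes. -/
theorem eval_cosTrunc_sinTrunc_node {p k : ℕ} (hk : k ≤ p) {τ : ℝ} (hτ : 2 * τ = 2 * k - p)
    (φ : ℝ) :
    (cosTrunc p φ).eval τ = Real.cos (2 * τ * φ) ∧
      (sinTrunc p φ).eval τ = Real.sin (2 * τ * φ) := by
  have h0 := secCoeff_eval_node hk hτ
  have hx := hasDerivAt_sineTrunc p τ
  have hy := hasDerivAt_secTrunc p τ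
  simp only [h0, mul_zero, zero_mul, sub_zero] at hy
  unfold cosTrunc sinTrunc
  split_ifs with he
  · have hs : (-1 : ℝ) ^ (p + 1) = -1 := Odd.neg_one_pow (by grind)
    simp only [hs] at hx hy
    simp only [eval_mul, eval_C]
    refine eq_cos_sin_of_hasDerivAt (u := fun φ => (sineTrunc p (Real.sin φ)).eval τ)
      (v := fun φ => Real.cos φ * (secTrunc p (Real.sin φ)).eval τ)
      (fun φ => ?_) (fun φ => ?_) ?_ ?_ φ
    · convert hx φ using 1; ring
    · convert hy φ using 1; ring
    · simp [sineTrunc_zero, he]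
    · simp [secTrunc_zero, he]
  · have hs : (-1 : ℝ) ^ (p + 1) = 1 := Even.neg_one_pow (by grind)
    simp only [hs] at hx hy
    simp only [eval_mul, eval_C]
    refine eq_cos_sin_of_hasDerivAt (v := fun φ => (sineTrunc p (Real.sin φ)).eval τ)
      (u := fun φ => Real.cos φ * (secTrunc p (Real.sin φ)).eval τ)
      (fun φ => ?_) (fun φ => ?_) ?_ ?_ φ
    · convert hy φ using 1; ring
    · convert hx φ using 1; ring
    · simp [secTrunc_zero, he]
    · simp [sineTrunc_zero, he]

end Trig

/-! ### Lagrange interpolation on the grid -/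

section Interpolation

open Polynomial

/-- The weight of the node `j` in the Lagrange interpolation of degree `p` on the nodes
`m, …, m + p`, at the point `x`. -/
noncomputable def weight (Δx : ℝ) (p : ℕ) (m : ℤ) (x : ℝ) (j : ℤ) : ℝ :=
  (Lagrange.basis (Finset.Icc m (m + p)) (node Δx) j).eval x

theorem node_injective {Δx : ℝ} (hΔx : 0 < Δx) : Function.Injective (node Δx) := fun i j h => by
  exact_mod_cast mul_right_cancel₀ hΔx.ne' h

theorem card_stencil (m : ℤ) (p : ℕ) : (Finset.Icc m (m + p)).card = p + 1 := by
  rw [Int.card_Icc]; omega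

theorem sum_weight_mul (Δx : ℝ) (p : ℕ) (m : ℤ) (x : ℝ) (V : ℤ → ℝ) :
    ∑ j ∈ Finset.Icc m (m + p), weight Δx p m x j * V j =
      (Lagrange.interpolate (Finset.Icc m (m + p)) (node Δx) V).eval x := by
  rw [Lagrange.interpolate_apply, eval_finsetSum]
  refine Finset.sum_congr rfl fun j _ => ?_
  rw [eval_mul, eval_C, weight, mul_comm]

theorem degree_lt_of_natDegree_lt_succ {P : ℝ[X]} {p : ℕ} (hP : P.natDegree ≤ p) :
    P.degree < ((p + 1 : ℕ) : WithBot ℕ) :=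
  (degree_le_of_natDegree_le hP).trans_lt (by exact_mod_cast Nat.lt_succ_self p)

/-- Interpolation of degree `p` is exact on the polynomials of degree at most `p`. -/
theorem sum_weight_mul_of_polynomial {Δx : ℝ} (hΔx : 0 < Δx) {p : ℕ} (m : ℤ) (x : ℝ)
    {V : ℤ → ℝ} {P : ℝ[X]} (hP : P.natDegree ≤ p)
    (hV : ∀ j ∈ Finset.Icc m (m + p), P.eval (node Δx j) = V j) :
    ∑ j ∈ Finset.Icc m (m + p), weight Δx p m x j * V j = P.eval x := by
  rw [sum_weight_mul, ← Lagrange.eq_interpolate_of_eval_eq V (node_injective hΔx).injOn _ hV]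
  rw [card_stencil]
  exact degree_lt_of_natDegree_lt_succ hP

theorem sum_weight {Δx : ℝ} (hΔx : 0 < Δx) (p : ℕ) (m : ℤ) (x : ℝ) :
    ∑ j ∈ Finset.Icc m (m + p), weight Δx p m x j = 1 := by
  simpa using sum_weight_mul_of_polynomial hΔx (p := p) m x (V := 1) (P := 1) (by simp) (by simp)

/-- Interpolation of degree `p` of a function of the centred grid coordinate that is
given at the nodes by a polynomial. -/
theorem sum_weight_mul_of_centred {Δx : ℝ} (hΔx : 0 < Δx) {p : ℕ} (m : ℤ) (x : ℝ)
    {f : ℝ → ℝ} {P : ℝ[X]} (hP : P.natDegree ≤ p)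
    (hV : ∀ j ∈ Finset.Icc m (m + p), P.eval (j - m - p / 2 : ℝ) = f (j - m - p / 2)) :
    ∑ j ∈ Finset.Icc m (m + p), weight Δx p m x j * f (j - m - p / 2) =
      P.eval (x / Δx - m - p / 2) := by
  have hev : ∀ y, (P.comp (C (1 / Δx) * X - C (m + p / 2 : ℝ))).eval y =
      P.eval (y / Δx - m - p / 2) := fun y => by
    rw [eval_comp]
    simp only [eval_sub, eval_mul, eval_C, eval_X]
    congr 1
    ring
  rw [← hev]
  refine sum_weight_mul_of_polynomial hΔx m x ?_ fun j hj => ?_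
  · refine natDegree_comp_le.trans ?_
    have : (C (1 / Δx) * X - C (m + p / 2 : ℝ) : ℝ[X]).natDegree ≤ 1 := by compute_degree
    calc _ ≤ p * 1 := Nat.mul_le_mul hP this
      _ = p := mul_one p
  · rw [hev, node, mul_div_cancel_right₀ _ hΔx.ne', hV j hj]

/-- The symbol of Lagrange interpolation on a centred stencil has modulus at most one
on the unit circle. -/
theorem norm_symbol_le_one_of_sin_nonneg {Δx : ℝ} (hΔx : 0 < Δx) {p : ℕ} {m : ℤ} {x : ℝ}
    (hp : Odd p → 4 * (x / Δx - m - p / 2) ^ 2 ≤ 1)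
    (hp' : Even p → 4 * (x / Δx - m - p / 2) ^ 2 ≤ 4) {φ : ℝ} (hφ : 0 ≤ Real.sin φ) :
    ‖∑ j ∈ Finset.Icc m (m + p),
      (weight Δx p m x j : ℂ) * Complex.exp ((2 * φ * j : ℝ) * Complex.I)‖ ≤ 1 := by
  have hnode : ∀ j ∈ Finset.Icc m (m + p),
      (cosTrunc p φ).eval (j - m - p / 2 : ℝ) = Real.cos (2 * (j - m - p / 2) * φ) ∧
      (sinTrunc p φ).eval (j - m - p / 2 : ℝ) = Real.sin (2 * (j - m - p / 2) * φ) :=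
      fun j hj => by
    obtain ⟨h1, h2⟩ := Finset.mem_Icc.1 hj
    obtain ⟨k, rfl⟩ : ∃ k : ℕ, j = m + k := ⟨(j - m).toNat, by omega⟩
    exact eval_cosTrunc_sinTrunc_node (p := p) (k := k) (by omega)
      (τ := ((m + k : ℤ) : ℝ) - m - p / 2) (by push_cast; ring) φ
  have hcos := sum_weight_mul_of_centred hΔx m x (natDegree_cosTrunc_le p φ)
    (f := fun τ => Real.cos (2 * τ * φ)) fun j hj => (hnode j hj).1
  have hsin := sum_weight_mul_of_centred hΔx m x (natDegree_sinTrunc_le p φ)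
    (f := fun τ => Real.sin (2 * τ * φ)) fun j hj => (hnode j hj).2
  -- The phase of the stencil centre `m + p/2` is factored out.
  have hfac : ∑ j ∈ Finset.Icc m (m + p),
      (weight Δx p m x j : ℂ) * Complex.exp ((2 * φ * j : ℝ) * Complex.I) =
      Complex.exp ((2 * φ * (m + p / 2) : ℝ) * Complex.I) * ⟨(cosTrunc p φ).eval
        (x / Δx - m - p / 2), (sinTrunc p φ).eval (x / Δx - m - p / 2)⟩ := by
    rw [← hcos, ← hsin, Complex.mk_eq_add_mul_I]
    push_cast
    rw [Finset.sum_mul, ← Finset.sum_add_distrib, Finset.mul_sum]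
    refine Finset.sum_congr rfl fun j _ => ?_
    have h : Complex.exp (2 * φ * j * Complex.I) = Complex.exp (2 * φ * (m + p / 2) * Complex.I) *
        (Complex.cos (2 * (j - m - p / 2) * φ) +
          Complex.sin (2 * (j - m - p / 2) * φ) * Complex.I) := by
      rw [← Complex.exp_mul_I, ← Complex.exp_add]
      congr 1
      ring
    linear_combination (weight Δx p m x j : ℂ) * h
  rw [hfac, norm_mul, Complex.norm_exp_ofReal_mul_I, one_mul, Complex.norm_def]
  refine Real.sqrt_le_one.2 ?_
  rw [Complex.normSq_mk, ← sq, ← sq]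
  exact cosTrunc_sq_add_sinTrunc_sq_le_one hp hp' hφ

theorem norm_symbol_le_one {Δx : ℝ} (hΔx : 0 < Δx) {p : ℕ} {m : ℤ} {x : ℝ}
    (hp : Odd p → 4 * (x / Δx - m - p / 2) ^ 2 ≤ 1)
    (hp' : Even p → 4 * (x / Δx - m - p / 2) ^ 2 ≤ 4) {z : ℂ} (hz : ‖z‖ = 1) :
    ‖∑ j ∈ Finset.Icc m (m + p), (weight Δx p m x j : ℂ) * z ^ j‖ ≤ 1 := by
  -- `φ` is determined by `z` only modulo `π`, and adding `π` flips the sign of `sin φ`.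
  obtain ⟨φ, hφ, rfl⟩ : ∃ φ : ℝ, 0 ≤ Real.sin φ ∧ Complex.exp ((2 * φ : ℝ) * Complex.I) = z := by
    have harg : Complex.exp (z.arg * Complex.I) = z := by
      simpa [hz] using Complex.norm_mul_exp_arg_mul_I z
    rcases le_total 0 (Real.sin (z.arg / 2)) with h | h
    · refine ⟨z.arg / 2, h, ?_⟩
      rw [mul_div_cancel₀ _ two_ne_zero, harg]
    · refine ⟨z.arg / 2 + Real.pi, by rw [Real.sin_add_pi]; linarith, ?_⟩
      rw [show ((2 * (z.arg / 2 + Real.pi) : ℝ) : ℂ) * Complex.I =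
        z.arg * Complex.I + 2 * Real.pi * Complex.I by push_cast; ring, Complex.exp_periodic, harg]
  convert norm_symbol_le_one_of_sin_nonneg hΔx hp hp' hφ using 4 with j hj
  rw [← Complex.exp_int_mul]
  congr 1
  push_cast
  ring

/-- On a centred stencil, the centred grid coordinate of the point is at most `1 / 2` if `p` is
odd, and at most `1` if `p` is even. -/
theorem CentredStencil.sq_le {p : ℕ} (S : CentredStencil p) (ξ : ℝ) :
    (Odd p → 4 * (ξ - S.start ξ - p / 2) ^ 2 ≤ 1) ∧
      (Even p → 4 * (ξ - S.start ξ - p / 2) ^ 2 ≤ 4) := by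
  have h := abs_le.1 (S.balanced ξ)
  have h1 := Int.floor_le ξ
  have h2 := Int.lt_floor_add_one ξ
  constructor
  · rintro ⟨r, rfl⟩
    have h3 : ⌊ξ⌋ = S.start ξ + r := by push_cast at h; omega
    have h4 : (⌊ξ⌋ : ℝ) = S.start ξ + r := by exact_mod_cast h3
    push_cast
    rw [h4] at h1 h2
    nlinarith
  · rintro ⟨r, rfl⟩
    have h3 : ⌊ξ⌋ ≤ S.start ξ + r := by push_cast at h; omega
    have h3' : S.start ξ + r ≤ ⌊ξ⌋ + 1 := by push_cast at h; omega
    have h4 : (⌊ξ⌋ : ℝ) ≤ S.start ξ + r := by exact_mod_cast h3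
    have h4' : (S.start ξ + r : ℝ) ≤ ⌊ξ⌋ + 1 := by exact_mod_cast h3'
    push_cast
    nlinarith

theorem CentredStencil.start_add_int {p : ℕ} (S : CentredStencil p) (ξ : ℝ) (i : ℤ) :
    S.start (ξ + i) = S.start ξ + i := by
  induction i with
  | zero => simp
  | succ n ih =>
    rw [Int.cast_add, Int.cast_one, ← add_assoc, S.start_add_one, ih]; ring
  | pred n ih =>
    have h := S.start_add_one (ξ + ((-(n : ℤ) - 1 : ℤ) : ℝ))
    rw [show ξ + ((-(n : ℤ) - 1 : ℤ) : ℝ) + 1 = ξ + ((-(n : ℤ) : ℤ) : ℝ) by push_cast; ring, ih] at h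
    omega

theorem lagrangeInterp_eq_sum (Δx : ℝ) {p : ℕ} (S : CentredStencil p) (V : ℤ → ℝ) (x : ℝ) :
    lagrangeInterp Δx S V x = ∑ j ∈ Finset.Icc (S.start (x / Δx)) (S.start (x / Δx) + p),
      weight Δx p (S.start (x / Δx)) x j * V j :=
  (sum_weight_mul _ _ _ _ _).symm

/-- Lagrange interpolation commutes with the shifts of the grid. -/
theorem lagrangeInterp_node_add {Δx : ℝ} (hΔx : 0 < Δx) {p : ℕ} (S : CentredStencil p)
    (V : ℤ → ℝ) (i : ℤ) (b : ℝ) :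
    lagrangeInterp Δx S V (node Δx i + b) =
      ∑ j ∈ Finset.Icc (S.start (b / Δx)) (S.start (b / Δx) + p),
        weight Δx p (S.start (b / Δx)) b j * V (i + j) := by
  have hdiv : (node Δx i + b) / Δx = b / Δx + i := by
    rw [node]; field_simp; ring
  rw [sum_weight_mul, lagrangeInterp, hdiv, S.start_add_int]
  set m := S.start (b / Δx)
  set P := Lagrange.interpolate (Finset.Icc (m + i) (m + i + p)) (node Δx) V with hPdef
  have hev : ∀ y, (P.comp (X + C (node Δx i))).eval y = P.eval (node Δx i + y) := fun y => by
    rw [eval_comp, eval_add, eval_X, eval_C, add_comm]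
  rw [← hev]
  -- The translated interpolant has degree at most `p` and the right values at `p + 1` nodes.
  refine congrArg (eval b) (Lagrange.eq_interpolate_of_eval_eq _ (node_injective hΔx).injOn ?_
    fun j hj => ?_)
  · rw [card_stencil]
    refine degree_lt_of_natDegree_lt_succ ?_
    rw [natDegree_comp, natDegree_X_add_C, mul_one]
    have h := Lagrange.degree_interpolate_le V (node_injective hΔx).injOn
      (s := Finset.Icc (m + i) (m + i + p))
    rw [card_stencil] at h
    exact natDegree_le_of_degree_le h
  · rw [hev, show node Δx i + node Δx j = node Δx (i + j) by simp only [node]; push_cast; ring]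
    refine Lagrange.eval_interpolate_at_node V (node_injective hΔx).injOn ?_
    rw [Finset.mem_Icc] at hj ⊢
    omega

/-- Piecewise linear interpolation is monotone. -/
theorem lagrangeInterp_one_mono {Δx : ℝ} (hΔx : 0 < Δx) (S : CentredStencil 1) (x : ℝ) :
    Monotone fun V : ℤ → ℝ => lagrangeInterp Δx S V x := by
  intro V W hVW
  simp only [lagrangeInterp_eq_sum]
  have h1 := Int.floor_le (x / Δx)
  have h2 := (Int.lt_floor_add_one (x / Δx)).le
  -- The two counts add up to `2` and differ by at most one, hence are equal.
  have h3 : S.start (x / Δx) = ⌊x / Δx⌋ := by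
    have h := abs_le.1 (S.balanced (x / Δx))
    push_cast at h
    omega
  rw [h3]
  set m := ⌊x / Δx⌋
  rw [le_div_iff₀ hΔx] at h1
  rw [div_le_iff₀ hΔx] at h2
  have hpair : Finset.Icc m (m + (1 : ℕ)) = {m, m + 1} := by
    ext j; simp only [Finset.mem_Icc, Finset.mem_insert, Finset.mem_singleton]; omega
  refine Finset.sum_le_sum fun j hj => mul_le_mul_of_nonneg_left (hVW j) ?_
  rw [weight, hpair]
  rw [hpair, Finset.mem_insert, Finset.mem_singleton] at hj
  have hd : node Δx (m + 1) - node Δx m = Δx := by simp only [node]; push_cast; ring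
  have hm1 : node Δx (m + 1) = (m + 1) * Δx := by simp [node]
  rcases hj with rfl | rfl
  · rw [Lagrange.basis_pair_left (by omega), Lagrange.basisDivisor]
    simp only [eval_mul, eval_C, eval_sub, eval_X]
    rw [← neg_sub (node Δx (m + 1)) (node Δx m), hd, hm1, inv_neg, neg_mul, ← mul_neg]
    exact mul_nonneg (inv_nonneg.2 hΔx.le) (by linarith)
  · rw [Lagrange.basis_pair_right (by omega), Lagrange.basisDivisor]
    simp only [eval_mul, eval_C, eval_sub, eval_X]
    rw [hd]
    exact mul_nonneg (inv_nonneg.2 hΔx.le) (by rw [node]; linarith)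

end Interpolation

/-! ### Contractive convolutions on `ℓ²(ℤ)` -/

section Convolution

open MeasureTheory AddCircle

theorem norm_sum_smul_fourierLp_sq (A : Finset ℤ) (c : ℤ → ℂ) :
    ‖∑ j ∈ A, c j • fourierLp (T := 1) 2 j‖ ^ 2 = ∑ j ∈ A, ‖c j‖ ^ 2 := by
  have h := orthonormal_fourier (T := 1) |>.inner_sum c c A
  rw [inner_self_eq_norm_sq_to_K] at h
  have h2 : ∀ j, (starRingEnd ℂ) (c j) * c j = ((‖c j‖ ^ 2 : ℝ) : ℂ) := fun j => by
    rw [mul_comm, Complex.mul_conj, Complex.normSq_eq_norm_sq]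
  simp only [h2] at h
  refine Complex.ofReal_injective ?_
  push_cast at h ⊢
  exact h

/-- Parseval's inequality for trigonometric polynomials that are comparable in modulus. -/
theorem sum_norm_sq_le_of_trigonometric {A B : Finset ℤ} {c d : ℤ → ℂ}
    (h : ∀ z : ℂ, ‖z‖ = 1 → ‖∑ j ∈ A, c j * z ^ j‖ ≤ ‖∑ j ∈ B, d j * z ^ j‖) :
    ∑ j ∈ A, ‖c j‖ ^ 2 ≤ ∑ j ∈ B, ‖d j‖ ^ 2 := by
  rw [← norm_sum_smul_fourierLp_sq, ← norm_sum_smul_fourierLp_sq]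
  have hcoe : ∀ (A : Finset ℤ) (c : ℤ → ℂ), ∑ j ∈ A, c j • fourierLp (T := 1) 2 j =
      ContinuousMap.toLp 2 haarAddCircle ℂ (∑ j ∈ A, c j • fourier j) := fun A c => by
    rw [map_sum]
    exact Finset.sum_congr rfl fun j _ => (map_smul _ _ _).symm
  have hval : ∀ (A : Finset ℤ) (c : ℤ → ℂ) (t : AddCircle (1 : ℝ)),
      (∑ j ∈ A, c j • fourier j : C(AddCircle (1 : ℝ), ℂ)) t =
        ∑ j ∈ A, c j * (toCircle t : ℂ) ^ j := fun A c t => by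
    rw [ContinuousMap.sum_apply]
    refine Finset.sum_congr rfl fun j _ => ?_
    rw [ContinuousMap.smul_apply, fourier_apply, toCircle_zsmul, Circle.coe_zpow, smul_eq_mul]
  rw [hcoe, hcoe]
  refine pow_le_pow_left₀ (norm_nonneg _) (Lp.norm_le_norm_of_ae_le ?_) 2
  filter_upwards [ContinuousMap.coeFn_toLp (p := 2) (𝕜 := ℂ) haarAddCircle
      (∑ j ∈ A, c j • fourier j : C(AddCircle (1 : ℝ), ℂ)),
    ContinuousMap.coeFn_toLp (p := 2) (𝕜 := ℂ) haarAddCircle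
      (∑ j ∈ B, d j • fourier j : C(AddCircle (1 : ℝ), ℂ))] with t h1 h2
  rw [h1, h2, hval, hval]
  exact h _ (Circle.norm_coe _)

/-- In generating functions in `z⁻¹` the operator becomes multiplication by its symbol; `hA` ensures
that `A` contains the whole support of the output. -/
theorem sum_convolution_sq_le_of_support {J A D : Finset ℤ} {w : ℤ → ℝ}
    (hw : ∀ z : ℂ, ‖z‖ = 1 → ‖∑ j ∈ J, (w j : ℂ) * z ^ j‖ ≤ 1) {W : ℤ → ℝ}
    (hW : ∀ j ∉ D, W j = 0) (hA : ∀ j ∈ J, ∀ k ∈ D, k - j ∈ A) :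
    ∑ i ∈ A, (∑ j ∈ J, w j * W (i + j)) ^ 2 ≤ ∑ j ∈ D, W j ^ 2 := by
  have key : ∀ z : ℂ, ‖z‖ = 1 → ∑ i ∈ A, ((∑ j ∈ J, w j * W (i + j) : ℝ) : ℂ) * z⁻¹ ^ i =
      (∑ j ∈ J, (w j : ℂ) * z ^ j) * ∑ k ∈ D, (W k : ℂ) * z⁻¹ ^ k := fun z hz => by
    have hz0 : z ≠ 0 := by rintro rfl; simp at hz
    push_cast
    simp_rw [Finset.sum_mul]
    rw [Finset.sum_comm]
    refine Finset.sum_congr rfl fun j hj => ?_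
    have himage : (D.image fun k => k - j) ⊆ A := by
      intro i hi
      obtain ⟨k, hk, rfl⟩ := Finset.mem_image.1 hi
      exact hA j hj k hk
    rw [← Finset.sum_subset himage, Finset.sum_image (by intro a _ b _ h; simpa using h),
      Finset.mul_sum]
    · refine Finset.sum_congr rfl fun k _ => ?_
      rw [sub_add_cancel, zpow_sub₀ (inv_ne_zero hz0), inv_zpow z j, div_inv_eq_mul]
      ring
    · intro i _ hi
      rw [hW (i + j) fun h => hi (Finset.mem_image.2 ⟨i + j, h, by ring⟩)]
      simp
  have h := sum_norm_sq_le_of_trigonometric (A := A) (B := D)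
    (c := fun i => ((∑ j ∈ J, w j * W (i + j) : ℝ) : ℂ)) (d := fun k => (W k : ℂ)) fun z hz => by
      have hz' : ‖z⁻¹‖ = 1 := by rw [norm_inv, hz, inv_one]
      have := key z⁻¹ hz'
      rw [inv_inv] at this
      rw [this, norm_mul]
      exact mul_le_of_le_one_left (norm_nonneg _) (hw _ hz')
  simpa [← Complex.ofReal_mul, ← Complex.ofReal_sum, Complex.norm_real] using h

/-- A finite convolution whose symbol has modulus at most one is a contraction of `ℓ²(ℤ)`. -/
theorem sum_convolution_sq_le {J : Finset ℤ} {w : ℤ → ℝ}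
    (hw : ∀ z : ℂ, ‖z‖ = 1 → ‖∑ j ∈ J, (w j : ℂ) * z ^ j‖ ≤ 1) {W : ℤ → ℝ} (hW : IsL2 W)
    (A : Finset ℤ) :
    ∑ i ∈ A, (∑ j ∈ J, w j * W (i + j)) ^ 2 ≤ ∑' j, W j ^ 2 := by
  classical
  -- `D` holds every index read from `A`, so cutting `W` off outside `D` changes nothing on `A`;
  -- `A'` also holds the support of the new output.
  let D : Finset ℤ := Finset.image₂ (· + ·) A J
  let A' : Finset ℤ := A ∪ Finset.image₂ (· - ·) D J
  let U : ℤ → ℝ := fun j => if j ∈ D then W j else 0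
  have h1 : ∀ i ∈ A, ∑ j ∈ J, w j * W (i + j) = ∑ j ∈ J, w j * U (i + j) := fun i hi =>
    Finset.sum_congr rfl fun j hj => by
      simp only [U]; rw [if_pos (Finset.mem_image₂_of_mem hi hj)]
  calc ∑ i ∈ A, (∑ j ∈ J, w j * W (i + j)) ^ 2
      = ∑ i ∈ A, (∑ j ∈ J, w j * U (i + j)) ^ 2 :=
        Finset.sum_congr rfl fun i hi => by rw [h1 i hi]
    _ ≤ ∑ i ∈ A', (∑ j ∈ J, w j * U (i + j)) ^ 2 :=
        Finset.sum_le_sum_of_subset_of_nonneg Finset.subset_union_left fun _ _ _ => sq_nonneg _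
    _ ≤ ∑ j ∈ D, U j ^ 2 :=
        sum_convolution_sq_le_of_support hw (fun j hj => if_neg hj) fun j hj k hk =>
          Finset.mem_union_right _ (Finset.mem_image₂_of_mem hk hj)
    _ = ∑ j ∈ D, W j ^ 2 := Finset.sum_congr rfl fun j hj => by simp only [U]; rw [if_pos hj]
    _ ≤ ∑' j, W j ^ 2 := hW.sum_le_tsum _ fun _ _ => sq_nonneg _

theorem l2norm_nonneg (Δx : ℝ) (W : ℤ → ℝ) : 0 ≤ l2norm Δx W := Real.sqrt_nonneg _

/-- A finite convolution whose weights have sum one and whose symbol has modulus at most one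
has norm one on `ℓ²(ℤ)`. -/
theorem hasL2OpNorm_convolution {Δx : ℝ} (hΔx : 0 < Δx) {m : ℤ} {p : ℕ} {w : ℤ → ℝ}
    (hw : ∀ z : ℂ, ‖z‖ = 1 → ‖∑ j ∈ Finset.Icc m (m + p), (w j : ℂ) * z ^ j‖ ≤ 1)
    (hw1 : ∑ j ∈ Finset.Icc m (m + p), w j = 1) :
    HasL2OpNorm Δx (fun W i => ∑ j ∈ Finset.Icc m (m + p), w j * W (i + j)) 1 := by
  have hL2 : ∀ W, IsL2 W → IsL2 fun i => ∑ j ∈ Finset.Icc m (m + p), w j * W (i + j) :=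
    fun W hW => summable_of_sum_le (fun _ => sq_nonneg _) (sum_convolution_sq_le hw hW)
  refine ⟨hL2, ⟨zero_le_one, fun W hW => ?_⟩, fun C hC => ?_⟩
  · rw [one_mul]
    exact Real.sqrt_le_sqrt (mul_le_mul_of_nonneg_left
      ((hL2 W hW).tsum_le_of_sum_le (sum_convolution_sq_le hw hW)) hΔx.le)
  · obtain ⟨hC0, hC⟩ := hC
    -- Test on the indicator of `N + p` consecutive indices: at `N` positions the whole stencil lies
    -- inside, and the output is `∑ w_j = 1`. Letting `N` grow forces `C ≥ 1`.
    have hN : ∀ N : ℕ, (N : ℝ) ≤ C ^ 2 * (N + p) := fun N => by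
      rcases Nat.eq_zero_or_pos N with rfl | hN0
      · simpa using mul_nonneg (sq_nonneg C) p.cast_nonneg
      let D := Finset.Ico (0 : ℤ) (N + p)
      let W : ℤ → ℝ := fun j => if j ∈ D then 1 else 0
      have hWsum : HasSum (fun j => W j ^ 2) (N + p) := by
        have h := hasSum_sum_of_ne_finset_zero (f := fun j => W j ^ 2) (s := D) (L := .unconditional ℤ)
          fun j hj => by simp [W, hj]
        have h2 : ∑ j ∈ D, W j ^ 2 = N + p := by
          rw [Finset.sum_congr rfl (g := fun _ => (1 : ℝ)) fun j hj => by simp [W, hj]]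
          rw [Finset.sum_const, Int.card_Ico, nsmul_eq_mul, mul_one, sub_zero]
          exact_mod_cast congrArg (Nat.cast (R := ℝ)) (Int.toNat_natCast (N + p))
        rwa [h2] at h
      have hWL2 : IsL2 W := hWsum.summable
      have hB : (N : ℝ) ≤ ∑' i, (∑ j ∈ Finset.Icc m (m + p), w j * W (i + j)) ^ 2 := by
        refine le_trans (le_of_eq ?_) ((hL2 W hWL2).sum_le_tsum (Finset.Ico (-m) (N - m))
          fun _ _ => sq_nonneg _)
        rw [Finset.sum_congr rfl (g := fun _ => (1 : ℝ)) fun i hi => ?_]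
        · rw [Finset.sum_const, Int.card_Ico, nsmul_eq_mul, mul_one]
          simp
        · rw [Finset.sum_congr rfl (g := w) fun j hj => ?_, hw1, one_pow]
          have : i + j ∈ D := by
            simp only [D, Finset.mem_Ico, Finset.mem_Icc] at hi hj ⊢
            omega
          simp [W, this]
      have h := hC W hWL2
      rw [l2norm, l2norm, hWsum.tsum_eq] at h
      have h2 := pow_le_pow_left₀ (Real.sqrt_nonneg _) h 2
      rw [mul_pow, Real.sq_sqrt (mul_nonneg hΔx.le (tsum_nonneg fun _ => sq_nonneg _)),
        Real.sq_sqrt (by positivity)] at h2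
      refine le_of_mul_le_mul_left ?_ hΔx
      calc Δx * N ≤ _ := mul_le_mul_of_nonneg_left hB hΔx.le
        _ ≤ _ := h2
        _ = _ := by ring
    by_contra! hlt
    have hC1 : C ^ 2 < 1 := by nlinarith
    obtain ⟨N, hN'⟩ := exists_nat_gt (C ^ 2 * p / (1 - C ^ 2))
    rw [div_lt_iff₀ (by linarith)] at hN'
    linarith [hN N]

end Convolution

/-! ### The scheme -/

theorem isDisplacement_const_iff (Δx Δt ν₀ σ : ℝ) (δ : ℕ → ℤ → ℝ) :
    IsDisplacement Δx Δt (fun _ _ => ν₀) σ δ ↔ ∀ n i, δ n i = √(2 * Δt * ν₀) :=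
  Iff.rfl

theorem step_eq (I : (ℤ → ℝ) → ℝ → ℝ) (z δp δm : ℕ → ℤ → ℝ) (n : ℕ) (V : ℤ → ℝ) :
    step I z δp δm n V = (1 / 2 : ℝ) • opPlus I z δp n V + (1 / 2 : ℝ) • opMinus I z δm n V :=
  rfl

theorem step_monotone {I : (ℤ → ℝ) → ℝ → ℝ} {z δp δm : ℕ → ℤ → ℝ} {n : ℕ}
    (hp : Monotone (opPlus I z δp n)) (hm : Monotone (opMinus I z δm n)) :
    Monotone (step I z δp δm n) := fun V W h i =>
  add_le_add (mul_le_mul_of_nonneg_left (hp h i) (by norm_num))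
    (mul_le_mul_of_nonneg_left (hm h i) (by norm_num))

/-- Lagrange interpolation of a sequence at a shifted grid has norm one on `ℓ²(ℤ)`. -/
theorem hasL2OpNorm_lagrangeInterp_shift {Δx : ℝ} (hΔx : 0 < Δx) {p : ℕ} (S : CentredStencil p)
    (b : ℝ) : HasL2OpNorm Δx (fun W i => lagrangeInterp Δx S W (node Δx i + b)) 1 := by
  simp only [lagrangeInterp_node_add hΔx]
  obtain ⟨h1, h2⟩ := S.sq_le (b / Δx)
  exact hasL2OpNorm_convolution hΔx (fun z hz => norm_symbol_le_one hΔx h1 h2 hz)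
    (sum_weight hΔx _ _ _)

/-- Pointwise convexity of the square gives both summability and the bound. -/
theorem l2norm_mean_le {Δx : ℝ} (hΔx : 0 < Δx) {U V : ℤ → ℝ} {c : ℝ} (hU : IsL2 U) (hV : IsL2 V)
    (hUc : l2norm Δx U ≤ c) (hVc : l2norm Δx V ≤ c) :
    IsL2 ((1 / 2 : ℝ) • U + (1 / 2 : ℝ) • V) ∧
      l2norm Δx ((1 / 2 : ℝ) • U + (1 / 2 : ℝ) • V) ≤ c := by
  have hc : 0 ≤ c := (l2norm_nonneg _ _).trans hUc
  have hle : ∀ j, ((1 / 2 : ℝ) • U + (1 / 2 : ℝ) • V) j ^ 2 ≤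
      1 / 2 * U j ^ 2 + 1 / 2 * V j ^ 2 := fun j => by
    simp only [Pi.add_apply, Pi.smul_apply, smul_eq_mul]
    nlinarith [sq_nonneg (U j - V j)]
  have hsum : Summable fun j => 1 / 2 * U j ^ 2 + 1 / 2 * V j ^ 2 :=
    (Summable.mul_left _ hU).add (Summable.mul_left _ hV)
  have hL2 : IsL2 ((1 / 2 : ℝ) • U + (1 / 2 : ℝ) • V) :=
    Summable.of_nonneg_of_le (fun _ => sq_nonneg _) hle hsum
  refine ⟨hL2, Real.sqrt_le_iff.2 ⟨hc, ?_⟩⟩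
  have h := hL2.tsum_le_tsum hle hsum
  rw [(Summable.mul_left _ hU).tsum_add (Summable.mul_left _ hV), tsum_mul_left,
    tsum_mul_left] at h
  have h1 := (Real.sqrt_le_iff.1 hUc).2
  have h2 := (Real.sqrt_le_iff.1 hVc).2
  have h3 := mul_le_mul_of_nonneg_left h hΔx.le
  linarith

theorem step_l2norm_le {Δx : ℝ} (hΔx : 0 < Δx) {I : (ℤ → ℝ) → ℝ → ℝ} {z δp δm : ℕ → ℤ → ℝ}
    {n : ℕ} (hp : HasL2OpNorm Δx (opPlus I z δp n) 1) (hm : HasL2OpNorm Δx (opMinus I z δm n) 1)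
    {V : ℤ → ℝ} (hV : IsL2 V) :
    IsL2 (step I z δp δm n V) ∧ l2norm Δx (step I z δp δm n V) ≤ l2norm Δx V := by
  rw [step_eq]
  exact l2norm_mean_le hΔx (hp.1 V hV) (hm.1 V hV) (by simpa using hp.2.1.2 V hV)
    (by simpa using hm.2.1.2 V hV)

theorem solution_l2_stable {Δx : ℝ} (hΔx : 0 < Δx) {I : (ℤ → ℝ) → ℝ → ℝ} {z δp δm : ℕ → ℤ → ℝ}
    (h : ∀ n, HasL2OpNorm Δx (opPlus I z δp n) 1 ∧ HasL2OpNorm Δx (opMinus I z δm n) 1)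
    {V : ℕ → ℤ → ℝ} (hV : IsSolution I z δp δm V) (hV0 : IsL2 (V 0)) (n : ℕ) :
    IsL2 (V n) ∧ l2norm Δx (V (n + 1)) ≤ l2norm Δx (V n) ∧ l2norm Δx (V n) ≤ l2norm Δx (V 0) := by
  have hstep : ∀ n, IsL2 (V n) → IsL2 (V (n + 1)) ∧ l2norm Δx (V (n + 1)) ≤ l2norm Δx (V n) :=
    fun n hn => by rw [hV n]; exact step_l2norm_le hΔx (h n).1 (h n).2 hn
  have hL2 : ∀ n, IsL2 (V n) := fun n => by
    induction n with
    | zero => exact hV0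
    | succ n ih => exact (hstep n ih).1
  exact ⟨hL2 n, (hstep n (hL2 n)).2,
    antitone_nat_of_succ_le (f := fun n => l2norm Δx (V n)) (fun n => (hstep n (hL2 n)).2)
      n.zero_le⟩

end SLDiff

theorem mainTheorem2 (Δx Δt : ℝ) (hΔx : 0 < Δx) (hΔt : 0 < Δt) :
    -- the scheme is the mean of the two interpolation-shift operators
    (∀ (I : (ℤ → ℝ) → ℝ → ℝ) (z δp δm : ℕ → ℤ → ℝ) (n : ℕ) (V : ℤ → ℝ),
      SLDiff.step I z δp δm n V =
        (1 / 2 : ℝ) • SLDiff.opPlus I z δp n V + (1 / 2 : ℝ) • SLDiff.opMinus I z δm n V) ∧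
    -- constant diffusivity: all the displacements coincide
    (∀ ν₀ : ℝ, 0 ≤ ν₀ → ∀ δ : ℕ → ℤ → ℝ,
      (SLDiff.IsDisplacement Δx Δt (fun _ _ => ν₀) 1 δ ↔ ∀ n i, δ n i = √(2 * Δt * ν₀)) ∧
      (SLDiff.IsDisplacement Δx Δt (fun _ _ => ν₀) (-1) δ ↔ ∀ n i, δ n i = √(2 * Δt * ν₀))) ∧
    -- constant coefficients, Lagrange interpolation of any order: norm one, and stability
    (∀ (ν₀ a : ℝ), 0 ≤ ν₀ → ∀ δp δm : ℕ → ℤ → ℝ,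
      SLDiff.IsDisplacement Δx Δt (fun _ _ => ν₀) 1 δp →
      SLDiff.IsDisplacement Δx Δt (fun _ _ => ν₀) (-1) δm →
      ∀ z : ℕ → ℤ → ℝ, (∀ n i, z n i = SLDiff.node Δx i - a * Δt) →
      ∀ p : ℕ, 1 ≤ p → ∀ S : SLDiff.CentredStencil p,
        (∀ n, SLDiff.HasL2OpNorm Δx (SLDiff.opPlus (SLDiff.lagrangeInterp Δx S) z δp n) 1 ∧
          SLDiff.HasL2OpNorm Δx (SLDiff.opMinus (SLDiff.lagrangeInterp Δx S) z δm n) 1) ∧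
        (∀ V : ℕ → ℤ → ℝ, SLDiff.IsSolution (SLDiff.lagrangeInterp Δx S) z δp δm V →
          SLDiff.IsL2 (V 0) → ∀ n, SLDiff.IsL2 (V n) ∧
            SLDiff.l2norm Δx (V (n + 1)) ≤ SLDiff.l2norm Δx (V n) ∧
            SLDiff.l2norm Δx (V n) ≤ SLDiff.l2norm Δx (V 0))) ∧
    -- variable coefficients: monotone interpolation-shift operators give a monotone scheme,
    -- and those of the interpolation of degree one are monotone
    (∀ ν : ℝ → ℝ → ℝ, (∀ x t, 0 ≤ ν x t) → ∀ δp δm : ℕ → ℤ → ℝ,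
      SLDiff.IsDisplacement Δx Δt ν 1 δp → SLDiff.IsDisplacement Δx Δt ν (-1) δm →
      ∀ z : ℕ → ℤ → ℝ,
        (∀ (I : (ℤ → ℝ) → ℝ → ℝ) (n : ℕ), Monotone (SLDiff.opPlus I z δp n) →
          Monotone (SLDiff.opMinus I z δm n) → Monotone (SLDiff.step I z δp δm n)) ∧
        (∀ (S : SLDiff.CentredStencil 1) (n : ℕ),
          Monotone (SLDiff.opPlus (SLDiff.lagrangeInterp Δx S) z δp n) ∧
          Monotone (SLDiff.opMinus (SLDiff.lagrangeInterp Δx S) z δm n) ∧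
          Monotone (SLDiff.step (SLDiff.lagrangeInterp Δx S) z δp δm n))) := by
  refine ⟨SLDiff.step_eq, fun ν₀ _ δ => ⟨SLDiff.isDisplacement_const_iff _ _ _ _ _,
    SLDiff.isDisplacement_const_iff _ _ _ _ _⟩, ?_, ?_⟩
  · intro ν₀ a _ δp δm hp hm z hz p _ S
    rw [SLDiff.isDisplacement_const_iff] at hp hm
    -- Both operators interpolate at `x_i + b` with `b = ±δ - aΔt` independent of `i`; the size of
    -- `b` relative to `Δx` is immaterial.
    have hop : ∀ n, SLDiff.HasL2OpNorm Δx (SLDiff.opPlus (SLDiff.lagrangeInterp Δx S) z δp n) 1 ∧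
        SLDiff.HasL2OpNorm Δx (SLDiff.opMinus (SLDiff.lagrangeInterp Δx S) z δm n) 1 := fun n => by
      constructor
      · convert SLDiff.hasL2OpNorm_lagrangeInterp_shift hΔx S (√(2 * Δt * ν₀) - a * Δt) using 4
        rw [SLDiff.opPlus, hz, hp]
        congr 1
        ring
      · convert SLDiff.hasL2OpNorm_lagrangeInterp_shift hΔx S (-√(2 * Δt * ν₀) - a * Δt) using 4
        rw [SLDiff.opMinus, hz, hm]
        congr 1
        ring
    exact ⟨hop, fun V hV hV0 => SLDiff.solution_l2_stable hΔx hop hV hV0⟩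
  · intro ν _ δp δm _ _ z
    refine ⟨fun I n => SLDiff.step_monotone, fun S n => ?_⟩
    have h1 : Monotone (SLDiff.opPlus (SLDiff.lagrangeInterp Δx S) z δp n) := fun V W h i =>
      SLDiff.lagrangeInterp_one_mono hΔx S _ h
    have h2 : Monotone (SLDiff.opMinus (SLDiff.lagrangeInterp Δx S) z δm n) := fun V W h i =>
      SLDiff.lagrangeInterp_one_mono hΔx S _ h
    exact ⟨h1, h2, SLDiff.step_monotone h1 h2⟩
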